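/- Let $d\ge 1$ and let $D\subset\mathbb{R}^d$ be a non-empty bounded open set (for instance a bounded domain with Lipschitz boundary, $d\in\{1,2,3\}$). Let $H_0^1(D)$ be the closure of $C_c^\infty(D)$ in $H^1(D)$, normed by $\|v\|_{H_0^1(D)}=\|\nabla v\|_{L_2(D)}$, let $H^{-1}(D)$ be its dual with the dual norm, and let $c_D$ be the Poincaré constant, i.e. the norm of the embedding $H_0^1(D)\hookrightarrow L_2(D)$. Let $U=[0,1]^{\mathbb{N}}$ carry the product uniform measure $\mathrm{d}\boldsymbol{y}$. Let $a_0\in L_\infty(D)$, $\psi_j\in L_\infty(D)$ for $j\ge 1$, with $\sum_{j\ge1}\|\psi_j\|_{L_\infty(D)}<\infty$, with $\sum_{j\ge1}\|\psi_j\|_{L_\infty(D)}^p<\infty$ for some $0<p<1$, and with $\|\psi_1\|_{L_\infty(D)}\ge\|\psi_2\|_{L_\infty(D)}\ge\cdots$. Let $\xi\in L_\infty([0,1])$ be real-valued with $\int_0^1\xi(y)\,\mathrm{d}y=0$, and suppose that $$a(\boldsymbol{x},\boldsymbol{y})=a_0(\boldsymbol{x})+\sum_{j\ge1}\xi(y_j)\,\psi_j(\boldsymbol{x})$$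 satisfies $0<a_{\min}\le a(\boldsymbol{x},\boldsymbol{y})\le a_{\max}<\infty$ for almost all $\boldsymbol{y}\in U$ and almost all $\boldsymbol{x}\in D$, with constants $a_{\min},a_{\max}$. For $s\in\mathbb{N}$ put $a_s(\boldsymbol{x},\boldsymbol{y})=a_0(\boldsymbol{x})+\sum_{j=1}^{s}\xi(y_j)\,\psi_j(\boldsymbol{x})$. Then $0<c_D<\infty$ and $\|v\|_{L_2(D)}\le c_D\|\nabla v\|_{L_2(D)}$ for all $v\in H_0^1(D)$. For almost every $\boldsymbol{y}\in U$, the following holds for every $q\in H^{-1}(D)$: there is a unique $u=u(\cdot,\boldsymbol{y})\in H_0^1(D)$ with $$\int_D a(\boldsymbol{x},\boldsymbol{y})\,\nabla u(\boldsymbol{x},\boldsymbol{y})\cdot\nabla\phi(\boldsymbol{x})\,\mathrm{d}\boldsymbol{x}=\langle q,\phi\rangle_{H^{-1}(D),H_0^1(D)}\qquad\text{for all }\phi\in H_0^1(D),$$ and, for every $s$, a unique $u_s=u_s(\cdot,\boldsymbol{y})\in H_0^1(D)$ satisfying the same equation with $a_s$ in place of $a$. Moreover there is a constant $C>0$, independent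 of $s$ and $q$, such that for all $s\ge 1$ and all $q\in H^{-1}(D)$ the functions $u$ and $u_s$ belong to $L_2(U;H_0^1(D))$ and $$\sqrt{\int_U\int_D (u-u_s)^2\,\mathrm{d}\boldsymbol{x}\,\mathrm{d}\boldsymbol{y}}\;\le\; c_D\sqrt{\int_U\int_D|\nabla(u-u_s)|^2\,\mathrm{d}\boldsymbol{x}\,\mathrm{d}\boldsymbol{y}}\;\le\; C\,\|q\|_{H^{-1}(D)}\,s^{-\left(\frac1p-\frac12\right)}.$$ -/

import Mathlib

open MeasureTheory TopologicalSpace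
open scoped ENNReal Distributions

noncomputable section

/-- Physical space `ℝ^d` with the Euclidean norm. -/
abbrev Space (d : ℕ) : Type := EuclideanSpace ℝ (Fin d)

/-- Lebesgue measure on the open set `D`. -/
abbrev domainMeasure {d : ℕ} (D : Opens (Space d)) : Measure (Space d) :=
  volume.restrict (D : Set (Space d))

/-- `L₂(D) × L₂(D; ℝ^d)`, with norm `(‖v‖² + ‖g‖²)^(1/2)`; the map `v ↦ (v, ∇v)` embeds `H¹(D)`
isometrically into it. -/
abbrev SobolevAmbient {d : ℕ} (D : Opens (Space d)) : Type :=
  WithLp 2 (Lp ℝ 2 (domainMeasure D) × Lp (Space d) 2 (domainMeasure D))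

lemma testFunction_differentiable {d : ℕ} {D : Opens (Space d)} (φ : 𝓓(D, ℝ)) :
    Differentiable ℝ φ := φ.contDiff.differentiable (by simp)

/-- The pairs `(φ, ∇φ)` with `φ ∈ C_c^∞(D)`. -/
def testGraph {d : ℕ} (D : Opens (Space d)) : Submodule ℝ (SobolevAmbient D) where
  carrier := {w | ∃ φ : 𝓓(D, ℝ),
    w.fst =ᵐ[domainMeasure D] φ ∧ w.snd =ᵐ[domainMeasure D] gradient φ}
  zero_mem' := by
    refine ⟨0, ?_, ?_⟩
    · filter_upwards [Lp.coeFn_zero ℝ 2 (domainMeasure D)] with x hx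
      simpa using hx
    · filter_upwards [Lp.coeFn_zero (Space d) 2 (domainMeasure D)] with x hx
      have h0 : ((0 : 𝓓(D, ℝ)) : Space d → ℝ) = fun _ => (0 : ℝ) := rfl
      rw [h0, gradient_fun_const]
      simpa using hx
  add_mem' := by
    rintro v w ⟨φ, h1, h2⟩ ⟨χ, h3, h4⟩
    refine ⟨φ + χ, ?_, ?_⟩
    · filter_upwards [Lp.coeFn_add v.fst w.fst, h1, h3] with x hx h1 h3
      rw [WithLp.add_fst, hx]
      simp [h1, h3]
    · filter_upwards [Lp.coeFn_add v.snd w.snd, h2, h4] with x hx h2 h4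
      have h0 : ((φ + χ : 𝓓(D, ℝ)) : Space d → ℝ) = (φ : Space d → ℝ) + χ := rfl
      rw [WithLp.add_snd, hx, Pi.add_apply, h2, h4, h0]
      simp only [gradient]
      rw [fderiv_add (testFunction_differentiable φ x) (testFunction_differentiable χ x), map_add]
  smul_mem' := by
    rintro c v ⟨φ, h1, h2⟩
    refine ⟨c • φ, ?_, ?_⟩
    · filter_upwards [Lp.coeFn_smul c v.fst, h1] with x hx h1
      rw [WithLp.smul_fst, hx]
      simp [h1]
    · filter_upwards [Lp.coeFn_smul c v.snd, h2] with x hx h2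
      have h0 : ((c • φ : 𝓓(D, ℝ)) : Space d → ℝ) = c • (φ : Space d → ℝ) := rfl
      rw [WithLp.smul_snd, hx, Pi.smul_apply, h2, h0]
      simp only [gradient]
      rw [fderiv_const_smul (testFunction_differentiable φ x)]
      simp

/-- The Sobolev space `H¹₀(D)`: the closure of `C_c^∞(D)` in the `H¹(D)` norm. An element is
represented by the pair consisting of the function and its weak gradient. -/
def H01 {d : ℕ} (D : Opens (Space d)) : Submodule ℝ (SobolevAmbient D) :=
  (testGraph D).topologicalClosure

/-- The underlying `L₂(D)` function of an element of `H¹₀(D)`. -/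
def H01.val {d : ℕ} {D : Opens (Space d)} (v : H01 D) : Lp ℝ 2 (domainMeasure D) :=
  (v : SobolevAmbient D).fst

/-- The weak gradient of an element of `H¹₀(D)`. -/
def H01.grad {d : ℕ} {D : Opens (Space d)} (v : H01 D) : Lp (Space d) 2 (domainMeasure D) :=
  (v : SobolevAmbient D).snd

/-- The dual space `H⁻¹(D)` of bounded linear functionals on `H¹₀(D)`. -/
abbrev Hminus1 {d : ℕ} (D : Opens (Space d)) : Type := StrongDual ℝ (H01 D)

/-- The norm of `H⁻¹(D)` dual to the norm `‖∇v‖_{L₂(D)}` of `H¹₀(D)`. -/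
def Hminus1Norm {d : ℕ} {D : Opens (Space d)} (q : Hminus1 D) : ℝ :=
  sInf {c : ℝ | 0 ≤ c ∧ ∀ v : H01 D, |q v| ≤ c * ‖H01.grad v‖}

/-- The Poincaré constant of `D`: the norm of the embedding of `H¹₀(D)`, normed by
`‖∇v‖_{L₂(D)}`, into `L₂(D)`. -/
def poincareConst {d : ℕ} (D : Opens (Space d)) : ℝ :=
  sInf {c : ℝ | 0 ≤ c ∧ ∀ v : H01 D, ‖H01.val v‖ ≤ c * ‖H01.grad v‖}

/-- `v ∈ H¹₀(D)` solves `-∇·(α ∇v) = q` weakly. -/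
def IsWeakSolution {d : ℕ} (D : Opens (Space d)) (α : Space d → ℝ) (q : Hminus1 D)
    (v : H01 D) : Prop :=
  ∀ φ : H01 D, ∫ x in (D : Set (Space d)), α x * inner ℝ (H01.grad v x) (H01.grad φ x) = q φ

/-- The norm of `L_∞(D)`. -/
def LinftyNorm {d : ℕ} (D : Opens (Space d)) (f : Space d → ℝ) : ℝ :=
  (eLpNorm f ∞ (domainMeasure D)).toReal

/-- The parameter space `U = [0,1]^ℕ`; coordinates are numbered from `0`. -/
abbrev ParamSpace : Type := ℕ → unitInterval

/-- The product uniform measure on `U`. -/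
def paramMeasure : Measure ParamSpace :=
  Measure.infinitePi fun _ : ℕ => (volume : Measure unitInterval)

/-- `a(x, y) = a₀(x) + ∑_j ξ(y_j) ψ_j(x)`. -/
def coeff {d : ℕ} (a₀ : Space d → ℝ) (ψ : ℕ → Space d → ℝ) (ξ : unitInterval → ℝ)
    (y : ParamSpace) (x : Space d) : ℝ :=
  a₀ x + ∑' j, ξ (y j) * ψ j x

/-- The truncation of `coeff` to the first `s` terms of the sum. -/
def truncCoeff {d : ℕ} (a₀ : Space d → ℝ) (ψ : ℕ → Space d → ℝ) (ξ : unitInterval → ℝ)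
    (s : ℕ) (y : ParamSpace) (x : Space d) : ℝ :=
  a₀ x + ∑ j ∈ Finset.range s, ξ (y j) * ψ j x

end

/-! ### The Poincaré inequality -/

/-! Testing the equations for `u` and `u_s` with `u - u_s` and using coercivity gives `‖∇(u - u_s)‖
≤ ‖(a - a_s) ∇u_s‖ / amin`. Here `∇u_s` depends only on the first `s` parameters and `a - a_s` only
on the others. With the first `s` parameters frozen, `(a - a_s) ∇u_s = ∑_{j ≥ s} ξ(y_j) ψ_j ∇u_s` is
a series of independent centred terms in the Hilbert space `L₂(D; ℝ^d)`. The terms are orthogonal in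
mean square, so its second moment is at most a constant times `∑_{j ≥ s} ‖ψ_j‖² ‖∇u_s‖²`
(`integral_norm_sq_tsum_smul_le`). The a priori bound for `∇u_s` and Stechkin's estimate
`tsum_tail_sq_le` then give the rate. The triangle inequality would only give `∑_{j ≥ s} ‖ψ_j‖`,
hence half an order less.

Three supporting facts are needed. The truncated coefficient is still coercive, being the average of
`a` over the remaining parameters (`ae_coercive_truncAffineOperator`). Solutions depend measurably
on `y`, because inversion of operators is continuous on the units
(`stronglyMeasurable_ringInverse_comp`). Freezing parameters is made rigorous by the
measure-preserving map `glueAt` and Fubini. The variational part is carried out for abstract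
operators `A` on a Hilbert space and a bounded map `G` in place of the gradient. -/

lemma norm_sq_Lp_two_eq_integral {α E : Type*} [MeasurableSpace α] {μ : Measure α}
    [NormedAddCommGroup E] [InnerProductSpace ℝ E] (f : Lp E 2 μ) :
    ‖f‖ ^ 2 = ∫ x, ‖f x‖ ^ 2 ∂μ := by
  rw [← real_inner_self_eq_norm_sq, L2.inner_def]
  simp only [real_inner_self_eq_norm_sq]

lemma norm_gradient {E : Type*} [NormedAddCommGroup E] [InnerProductSpace ℝ E] [CompleteSpace E]
    (f : E → ℝ) (x : E) : ‖gradient f x‖ = ‖fderiv ℝ f x‖ := by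
  rw [gradient, LinearIsometryEquiv.norm_map]

/-- Integration by parts of `φ ^ 2` against a linear functional taking the value `1` at `e`. -/
lemma integral_sq_eq_of_compactSupport {E : Type*} [NormedAddCommGroup E] [NormedSpace ℝ E]
    [FiniteDimensional ℝ E] [MeasurableSpace E] [BorelSpace E] (μ : Measure E) [μ.IsAddHaarMeasure]
    (ℓ : StrongDual ℝ E) (e : E) (he : ℓ e = 1) {φ : E → ℝ} (hφ : ContDiff ℝ 1 φ)
    (hc : HasCompactSupport φ) :
    ∫ x, φ x ^ 2 ∂μ = ∫ x, -(2 * φ x * fderiv ℝ φ x e * ℓ x) ∂μ := by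
  have hd : Differentiable ℝ φ := hφ.differentiable (by simp)
  have hcont : Continuous φ := hφ.continuous
  have hdc : Continuous (fun x => fderiv ℝ φ x e) := (hφ.continuous_fderiv (by simp)).clm_apply
    continuous_const
  have hsq : ∀ x, fderiv ℝ (fun x => φ x ^ 2) x e = 2 * φ x * fderiv ℝ φ x e := by
    intro x
    have := ((hd x).hasFDerivAt.pow 2).fderiv
    rw [this]
    simp
  have hl : ∀ x, fderiv ℝ (fun x => ℓ x) x e = 1 := by
    intro x
    rw [ℓ.hasFDerivAt.fderiv, he]
  -- The derivative of `ℓ` along `e` is `1`, so integrating `φ ^ 2` against it moves the derivative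
  -- onto `φ ^ 2`; only `φ` needs compact support.
  have key := integral_mul_fderiv_eq_neg_fderiv_mul_of_integrable (μ := μ)
    (f := fun x => φ x ^ 2) (g := fun x => ℓ x) (v := e) ?_ ?_ ?_ ?_ ?_
  · simp only [hl, hsq, mul_one] at key
    rw [key, integral_neg]
  · simp only [hsq]
    apply Continuous.integrable_of_hasCompactSupport (by fun_prop)
    exact hc.mono fun x hx h => hx (by simp [h])
  · simp only [hl]
    apply Continuous.integrable_of_hasCompactSupport (by fun_prop)
    exact hc.mono fun x hx h => hx (by simp [h])
  · apply Continuous.integrable_of_hasCompactSupport (by fun_prop)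
    exact hc.mono fun x hx h => hx (by simp [h])
  · exact fun x _ => (hd x).pow 2
  · exact fun x _ => ℓ.differentiableAt

lemma TestFunction.fderiv_eq_zero_of_notMem {d : ℕ} {D : Opens (Space d)} (φ : 𝓓(D, ℝ))
    {x : Space d} (hx : x ∉ D) : fderiv ℝ φ x = 0 := by
  have := support_fderiv_subset ℝ (f := (φ : Space d → ℝ))
  by_contra h
  exact hx (φ.tsupport_subset (this h))

lemma TestFunction.eq_zero_of_notMem {d : ℕ} {D : Opens (Space d)} (φ : 𝓓(D, ℝ))
    {x : Space d} (hx : x ∉ D) : φ x = 0 := by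
  by_contra h
  exact hx (φ.tsupport_subset (subset_tsupport _ h))

/-- A coordinate function has slope one and is bounded by `R` on `D`, so `∫ φ² = -2 ∫ φ ∂ᵢφ xᵢ`.
Young's inequality bounds this by `½ ∫ φ² + 2R² ∫ |∇φ|²`; absorbing the first term gives the
constant `2R`. -/
lemma norm_fst_le_of_mem_testGraph {d : ℕ} (hd : 1 ≤ d) {D : Opens (Space d)} {R : ℝ}
    (hR0 : 0 ≤ R) (hR : ∀ x ∈ D, ‖x‖ ≤ R) {w : SobolevAmbient D} (hw : w ∈ testGraph D) :
    ‖w.fst‖ ≤ 2 * R * ‖w.snd‖ := by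
  obtain ⟨φ, h1, h2⟩ := hw
  have hφ : ContDiff ℝ 1 φ := φ.contDiff.of_le (by simp)
  have hcont : Continuous φ := φ.continuous
  have hdc : Continuous (fun x => fderiv ℝ φ x) := hφ.continuous_fderiv (by simp)
  let i : Fin d := ⟨0, hd⟩
  have hint1 : Integrable (fun x => φ x ^ 2) := by
    apply Continuous.integrable_of_hasCompactSupport (by fun_prop)
    exact φ.hasCompactSupport.mono fun x hx h => hx (by simp [h])
  have hint2 : Integrable (fun x => ‖fderiv ℝ φ x‖ ^ 2) := by
    apply Continuous.integrable_of_hasCompactSupport (by fun_prop)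
    exact (φ.hasCompactSupport.fderiv ℝ).mono fun x hx h => hx (by simp [h])
  have hparts := integral_sq_eq_of_compactSupport (volume : Measure (Space d))
    (EuclideanSpace.proj i) (EuclideanSpace.single i 1) (by simp) hφ φ.hasCompactSupport
  have hle : ∫ x, φ x ^ 2 ≤ ∫ x, (φ x ^ 2 / 2 + 2 * R ^ 2 * ‖fderiv ℝ φ x‖ ^ 2) := by
    rw [hparts]
    have hint3 : Integrable (fun x => -(2 * φ x * fderiv ℝ φ x (EuclideanSpace.single i 1) *
        (EuclideanSpace.proj i : StrongDual ℝ (Space d)) x)) := by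
      apply Continuous.integrable_of_hasCompactSupport (by fun_prop)
      exact φ.hasCompactSupport.mono fun x hx h => hx (by simp [h])
    refine integral_mono hint3 ((hint1.div_const 2).add (hint2.const_mul _)) fun x => ?_
    by_cases hx : x ∈ D
    · have e1 : |fderiv ℝ φ x (EuclideanSpace.single i 1)| ≤ ‖fderiv ℝ φ x‖ := by
        simpa using (fderiv ℝ φ x).le_opNorm (EuclideanSpace.single i 1)
      have e2 : |x i| ≤ R := (PiLp.norm_apply_le x i).trans (hR x hx)
      have e3 : |fderiv ℝ φ x (EuclideanSpace.single i 1) * x i| ≤ ‖fderiv ℝ φ x‖ * R := by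
        rw [abs_mul]; gcongr
      have e4 := sq_le_sq.2 (e3.trans (le_abs_self _))
      have e5 := sq_nonneg (φ x / 2 + fderiv ℝ φ x (EuclideanSpace.single i 1) * x i)
      simp only [EuclideanSpace.coe_proj]
      nlinarith
    · simp only [TestFunction.eq_zero_of_notMem φ hx]
      simp only [mul_zero, zero_mul, neg_zero]
      positivity
  rw [integral_add (hint1.div_const 2) (hint2.const_mul _), integral_div, integral_const_mul] at hle
  have n1 : ‖w.fst‖ ^ 2 = ∫ x, φ x ^ 2 := by
    rw [norm_sq_Lp_two_eq_integral, ← setIntegral_eq_integral_of_forall_compl_eq_zero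
      (μ := volume) (s := (D : Set (Space d))) (f := fun x => φ x ^ 2)
      (fun x hx => by rw [TestFunction.eq_zero_of_notMem φ hx]; simp)]
    refine integral_congr_ae ?_
    filter_upwards [h1] with x hx
    simp [hx]
  have n2 : ‖w.snd‖ ^ 2 = ∫ x, ‖fderiv ℝ φ x‖ ^ 2 := by
    rw [norm_sq_Lp_two_eq_integral, ← setIntegral_eq_integral_of_forall_compl_eq_zero
      (μ := volume) (s := (D : Set (Space d))) (f := fun x => ‖fderiv ℝ φ x‖ ^ 2)
      (fun x hx => by rw [TestFunction.fderiv_eq_zero_of_notMem φ hx]; simp)]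
    refine integral_congr_ae ?_
    filter_upwards [h2] with x hx
    rw [hx, norm_gradient]
  refine le_of_sq_le_sq ?_ (by positivity)
  rw [mul_pow, n1, n2]
  linarith

lemma exists_norm_val_le {d : ℕ} (hd : 1 ≤ d) (D : Opens (Space d))
    (hDb : Bornology.IsBounded (D : Set (Space d))) :
    ∃ c : ℝ, 0 ≤ c ∧ ∀ v : H01 D, ‖H01.val v‖ ≤ c * ‖H01.grad v‖ := by
  obtain ⟨R, hR⟩ := hDb.exists_norm_le
  have hR' : ∀ x ∈ D, ‖x‖ ≤ max R 0 := fun x hx => (hR x hx).trans (le_max_left _ _)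
  refine ⟨2 * max R 0, by positivity, fun v => ?_⟩
  have hclosed : IsClosed {w : SobolevAmbient D | ‖w.fst‖ ≤ 2 * max R 0 * ‖w.snd‖} := by
    refine isClosed_le ?_ ?_
    · exact (WithLp.continuous_fst 2 _ _).norm
    · exact continuous_const.mul (WithLp.continuous_snd 2 _ _).norm
  exact closure_minimal
    (fun w hw => norm_fst_le_of_mem_testGraph hd (le_max_right _ _) hR' hw) hclosed v.2

/-- The infimum is attained: every admissible constant dominates the quotient of the norms. When the
gradient vanishes, the explicit finite constant forces the function to vanish as well. -/
lemma norm_val_le_poincareConst {d : ℕ} (hd : 1 ≤ d) (D : Opens (Space d))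
    (hDb : Bornology.IsBounded (D : Set (Space d))) (v : H01 D) :
    ‖H01.val v‖ ≤ poincareConst D * ‖H01.grad v‖ := by
  obtain ⟨c, hc0, hc⟩ := exists_norm_val_le hd D hDb
  rcases (norm_nonneg (H01.grad v)).eq_or_lt with h | h
  · have := hc v
    rw [← h] at this ⊢
    simpa using this
  · rw [← div_le_iff₀ h]
    refine le_csInf ⟨c, hc0, hc⟩ fun b hb => ?_
    rw [div_le_iff₀ h]
    exact hb.2 v

/-- Functionals in `Hminus1 D` are bounded for the full `H¹` norm; the equivalence of norms `hc`
makes the set defining `Hminus1Norm` non-empty. -/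
lemma abs_apply_le_Hminus1Norm {d : ℕ} {D : Opens (Space d)} {c : ℝ}
    (hc : ∀ v : H01 D, ‖v‖ ≤ c * ‖H01.grad v‖) (hc0 : 0 ≤ c) (q : Hminus1 D) (v : H01 D) :
    |q v| ≤ Hminus1Norm q * ‖H01.grad v‖ := by
  have hmem : ∀ v : H01 D, |q v| ≤ ‖q‖ * c * ‖H01.grad v‖ := fun v => by
    refine (q.le_opNorm v).trans ?_
    rw [mul_assoc]
    gcongr
    exact hc v
  rcases (norm_nonneg (H01.grad v)).eq_or_lt with h | h
  · have := hmem v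
    rw [← h] at this ⊢
    simpa using this
  · rw [← div_le_iff₀ h]
    refine le_csInf ⟨‖q‖ * c, by positivity, hmem⟩ fun b hb => ?_
    rw [div_le_iff₀ h]
    exact hb.2 v

lemma Hminus1Norm_nonneg {d : ℕ} {D : Opens (Space d)} (q : Hminus1 D) : 0 ≤ Hminus1Norm q :=
  Real.sInf_nonneg fun _ hc => hc.1

lemma norm_sq_eq_val_add_grad {d : ℕ} {D : Opens (Space d)} (v : H01 D) :
    ‖v‖ ^ 2 = ‖H01.val v‖ ^ 2 + ‖H01.grad v‖ ^ 2 :=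
  WithLp.prod_norm_sq_eq_of_L2 (v : SobolevAmbient D)

lemma norm_grad_le {d : ℕ} {D : Opens (Space d)} (v : H01 D) : ‖H01.grad v‖ ≤ ‖v‖ := by
  refine le_of_sq_le_sq ?_ (norm_nonneg _)
  rw [norm_sq_eq_val_add_grad]
  nlinarith [sq_nonneg ‖H01.val v‖]

/-- The weak gradient as a bounded operator. -/
noncomputable def H01.gradL {d : ℕ} (D : Opens (Space d)) :
    H01 D →L[ℝ] Lp (Space d) 2 (domainMeasure D) :=
  LinearMap.mkContinuous
    { toFun := H01.grad
      map_add' := fun _ _ => rfl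
      map_smul' := fun _ _ => rfl } 1 (fun v => by rw [one_mul]; exact norm_grad_le v)

/-- A smooth bump at a point of `D` is continuous and non-zero there, hence not a.e. zero on the
open set `D`. This excludes a vanishing Poincaré constant. -/
lemma exists_mem_H01_val_ne_zero {d : ℕ} (D : Opens (Space d))
    (hDne : (D : Set (Space d)).Nonempty) : ∃ v : H01 D, H01.val v ≠ 0 := by
  obtain ⟨x, hx⟩ := hDne
  obtain ⟨f, hf1, hf2, hf3, -, hf5⟩ := exists_contDiff_tsupport_subset (n := ⊤)
    (D.isOpen.mem_nhds hx)
  let φ : 𝓓(D, ℝ) := ⟨f, hf3, hf2, hf1⟩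
  have hφ : ContDiff ℝ 1 φ := φ.contDiff.of_le (by simp)
  have hcont : Continuous φ := φ.continuous
  have m1 : MemLp φ 2 (domainMeasure D) :=
    (hcont.memLp_of_hasCompactSupport φ.hasCompactSupport).restrict _
  have hg : Continuous (gradient φ) :=
    (LinearIsometryEquiv.continuous _).comp (hφ.continuous_fderiv (by simp))
  have hgc : HasCompactSupport (gradient φ) :=
    (φ.hasCompactSupport.fderiv ℝ).mono fun x hx h => hx (by simp [gradient, h])
  have m2 : MemLp (gradient φ) 2 (domainMeasure D) :=
    (hg.memLp_of_hasCompactSupport hgc).restrict _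
  let w : SobolevAmbient D := WithLp.toLp 2 (m1.toLp, m2.toLp)
  have hw : w ∈ testGraph D := ⟨φ, m1.coeFn_toLp, m2.coeFn_toLp⟩
  refine ⟨⟨w, subset_closure hw⟩, fun h => ?_⟩
  have h0 : φ =ᵐ[domainMeasure D] 0 := (MemLp.toLp_eq_toLp_iff m1 MemLp.zero').1 (by
    change m1.toLp = 0 at h
    rw [h]; rfl)
  have := Measure.eqOn_open_of_ae_eq h0 D.isOpen hcont.continuousOn continuousOn_const hx
  change f x = 0 at this
  rw [hf5] at this
  exact one_ne_zero this

lemma poincareConst_pos {d : ℕ} (hd : 1 ≤ d) (D : Opens (Space d))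
    (hDne : (D : Set (Space d)).Nonempty) (hDb : Bornology.IsBounded (D : Set (Space d))) :
    0 < poincareConst D := by
  obtain ⟨v, hv⟩ := exists_mem_H01_val_ne_zero D hDne
  have h1 := norm_val_le_poincareConst hd D hDb v
  have h2 : 0 < ‖H01.val v‖ := norm_pos_iff.2 hv
  have h3 := norm_nonneg (H01.grad v)
  by_contra h
  nlinarith

lemma norm_le_mul_norm_grad {d : ℕ} (hd : 1 ≤ d) (D : Opens (Space d))
    (hDb : Bornology.IsBounded (D : Set (Space d))) (v : H01 D) :
    ‖v‖ ≤ √(poincareConst D ^ 2 + 1) * ‖H01.grad v‖ := by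
  refine le_of_sq_le_sq ?_ (by positivity)
  rw [norm_sq_eq_val_add_grad, mul_pow, Real.sq_sqrt (by positivity), add_mul, one_mul, ← mul_pow]
  gcongr
  exact norm_val_le_poincareConst hd D hDb v

/-! ### Splitting an infinite product and random series with centred coefficients -/

section RandomSeries

variable {X E : Type*} [NormedAddCommGroup E] [NormedSpace ℝ E]

/-- The sequence with the first `s` terms of the first argument and the other terms of the
second. -/
def glueAt (s : ℕ) (y : (ℕ → X) × (ℕ → X)) : ℕ → X :=
  fun i => if i < s then y.1 i else y.2 i

lemma norm_smul_le_of_bound {ξ : X → ℝ} {K : ℝ} (hK : ∀ t, |ξ t| ≤ K) (v : ℕ → E) (z : ℕ → X)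
    (j : ℕ) : ‖ξ (z j) • v j‖ ≤ K * ‖v j‖ := by
  rw [norm_smul, Real.norm_eq_abs]
  gcongr
  exact hK _

lemma summable_smul_of_bound [CompleteSpace E] {ξ : X → ℝ} {K : ℝ} (hK : ∀ t, |ξ t| ≤ K)
    {v : ℕ → E} (hv : Summable fun j => ‖v j‖) (z : ℕ → X) : Summable fun j => ξ (z j) • v j :=
  Summable.of_norm_bounded (hv.mul_left K) (norm_smul_le_of_bound hK v z)

lemma norm_tsum_smul_le_of_bound {ξ : X → ℝ} {K : ℝ} (hK : ∀ t, |ξ t| ≤ K)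
    {v : ℕ → E} (hv : Summable fun j => ‖v j‖) (z : ℕ → X) :
    ‖∑' j, ξ (z j) • v j‖ ≤ K * ∑' j, ‖v j‖ :=
  tsum_of_norm_bounded (hv.hasSum.mul_left K) (norm_smul_le_of_bound hK v z)

lemma norm_sum_range_smul_le_of_bound {ξ : X → ℝ} {K : ℝ} (hK : ∀ t, |ξ t| ≤ K) (hK0 : 0 ≤ K)
    {v : ℕ → E} (hv : Summable fun j => ‖v j‖) (z : ℕ → X) (n : ℕ) :
    ‖∑ j ∈ Finset.range n, ξ (z j) • v j‖ ≤ K * ∑' j, ‖v j‖ := by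
  refine (norm_sum_le _ _).trans ?_
  rw [← tsum_mul_left]
  exact (Finset.sum_le_sum fun j _ => norm_smul_le_of_bound hK v z j).trans
    ((hv.mul_left K).sum_le_tsum _ fun j _ => by positivity)

variable [MeasurableSpace X] {μ : Measure X} [IsProbabilityMeasure μ]

/-- Gluing two independent sequences gives a sequence with the original law, since the preimage of a
finite box is a product of two boxes. This replaces splitting the index set when the first `s`
coordinates are to be separated from the rest. -/
lemma measurePreserving_glueAt (s : ℕ) :
    MeasurePreserving (glueAt s)
      ((Measure.infinitePi fun _ : ℕ => μ).prod (Measure.infinitePi fun _ : ℕ => μ))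
      (Measure.infinitePi fun _ : ℕ => μ) := by
  have hm : Measurable (glueAt (X := X) s) := by
    refine measurable_pi_lambda _ fun i => ?_
    by_cases h : i < s
    · simpa [glueAt, h] using by fun_prop
    · simpa [glueAt, h] using by fun_prop
  refine ⟨hm, Measure.eq_infinitePi _ fun S t ht => ?_⟩
  have hS : MeasurableSet (Set.pi (S : Set ℕ) t) :=
    MeasurableSet.pi S.countable_toSet fun i _ => ht i
  rw [Measure.map_apply hm hS]
  have : glueAt s ⁻¹' (Set.pi (S : Set ℕ) t) =
      (Set.pi (S.filter (· < s) : Finset ℕ) t) ×ˢ (Set.pi (S.filter (¬ · < s) : Finset ℕ) t) := by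
    ext y
    simp only [glueAt, Set.mem_preimage, Set.mem_pi, Set.mem_prod, Finset.coe_filter,
      Set.mem_ofPred_eq, Finset.mem_coe]
    constructor
    · intro h
      exact ⟨fun i hi => by simpa [hi.2] using h i hi.1, fun i hi => by simpa [hi.2] using h i hi.1⟩
    · rintro ⟨h1, h2⟩ i hi
      by_cases his : i < s
      · simpa [his] using h1 i ⟨hi, his⟩
      · simpa [his] using h2 i ⟨hi, his⟩
  rw [this, Measure.prod_prod, Measure.infinitePi_pi _ fun i _ => ht i,
    Measure.infinitePi_pi _ fun i _ => ht i, Finset.prod_filter_mul_prod_filter_not]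

lemma stronglyMeasurable_sum_smul {ξ : X → ℝ} (hξ : Measurable ξ) (v : ℕ → E) (S : Finset ℕ) :
    StronglyMeasurable fun z : ℕ → X => ∑ j ∈ S, ξ (z j) • v j := by
  refine Finset.stronglyMeasurable_fun_sum _ fun j _ => ?_
  exact (hξ.comp (measurable_pi_apply j)).stronglyMeasurable.smul_const _

lemma stronglyMeasurable_tsum_smul [CompleteSpace E] {ξ : X → ℝ} (hξ : Measurable ξ) {K : ℝ}
    (hK : ∀ t, |ξ t| ≤ K) {v : ℕ → E} (hv : Summable fun j => ‖v j‖) :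
    StronglyMeasurable fun z : ℕ → X => ∑' j, ξ (z j) • v j := by
  refine stronglyMeasurable_of_tendsto Filter.atTop
    (fun n => stronglyMeasurable_sum_smul hξ v (Finset.range n)) ?_
  rw [tendsto_pi_nhds]
  exact fun z => (summable_smul_of_bound hK hv z).hasSum.tendsto_sum_nat

lemma integrable_comp_eval {ξ : X → ℝ} (hξ : Measurable ξ) {K : ℝ} (hK : ∀ t, |ξ t| ≤ K) (j : ℕ) :
    Integrable (fun z : ℕ → X => ξ (z j)) (Measure.infinitePi fun _ : ℕ => μ) :=
  Integrable.of_bound (hξ.comp (measurable_pi_apply j)).aestronglyMeasurable K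
    (Filter.Eventually.of_forall fun _ => hK _)

lemma integral_comp_eval {ξ : X → ℝ} (hξ : Measurable ξ) (j : ℕ) :
    ∫ z : ℕ → X, ξ (z j) ∂(Measure.infinitePi fun _ : ℕ => μ) = ∫ t, ξ t ∂μ := by
  have h := measurePreserving_eval_infinitePi (fun _ : ℕ => μ) j
  rw [← h.map_eq, integral_map h.measurable.aemeasurable hξ.aestronglyMeasurable]
  simp only [Function.eval]
  rw [h.map_eq]

lemma integral_tsum_smul_eq_zero [CompleteSpace E] {ξ : X → ℝ} (hξ : Measurable ξ) {K : ℝ}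
    (hK : ∀ t, |ξ t| ≤ K) (h0 : ∫ t, ξ t ∂μ = 0) {v : ℕ → E} (hv : Summable fun j => ‖v j‖) :
    ∫ z : ℕ → X, ∑' j, ξ (z j) • v j ∂(Measure.infinitePi fun _ : ℕ => μ) = 0 := by
  rw [← (hasSum_integral_of_summable_integral_norm (F := fun j (z : ℕ → X) => ξ (z j) • v j)
    (fun j => (integrable_comp_eval hξ hK j).smul_const _) ?_).tsum_eq]
  · simp [integral_smul_const, integral_comp_eval hξ, h0]
  · refine Summable.of_nonneg_of_le (fun j => by positivity) (fun j => ?_) (hv.mul_left K)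
    calc ∫ z : ℕ → X, ‖ξ (z j) • v j‖ ∂(Measure.infinitePi fun _ : ℕ => μ)
        ≤ ∫ z : ℕ → X, K * ‖v j‖ ∂(Measure.infinitePi fun _ : ℕ => μ) :=
          integral_mono ((integrable_comp_eval hξ hK j).smul_const _).norm (integrable_const _)
            fun z => norm_smul_le_of_bound hK v z j
      _ = K * ‖v j‖ := by simp

lemma integral_comp_eval_mul {ξ : X → ℝ} (hξ : Measurable ξ) {K : ℝ}
    (hK : ∀ t, |ξ t| ≤ K) (h0 : ∫ t, ξ t ∂μ = 0) {i j : ℕ} (hij : i ≠ j) :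
    ∫ z : ℕ → X, ξ (z i) * ξ (z j) ∂(Measure.infinitePi fun _ : ℕ => μ) = 0 := by
  have hind := ProbabilityTheory.iIndepFun_infinitePi (P := fun _ : ℕ => μ)
    (X := fun _ => ξ) (fun _ => hξ)
  have := (hind.indepFun hij).integral_fun_mul_eq_mul_integral
    (integrable_comp_eval hξ hK i).aestronglyMeasurable
    (integrable_comp_eval hξ hK j).aestronglyMeasurable
  rw [this, integral_comp_eval hξ, h0, zero_mul]

variable {F : Type*} [NormedAddCommGroup F] [InnerProductSpace ℝ F]

/-- Independence and zero mean kill the off-diagonal terms of the expanded square, so squares of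
norms add up instead of norms. -/
lemma integral_norm_sq_sum_smul_le {ξ : X → ℝ} (hξ : Measurable ξ) {K : ℝ}
    (hK : ∀ t, |ξ t| ≤ K) (h0 : ∫ t, ξ t ∂μ = 0) (v : ℕ → F) (S : Finset ℕ) :
    ∫ z : ℕ → X, ‖∑ j ∈ S, ξ (z j) • v j‖ ^ 2 ∂(Measure.infinitePi fun _ : ℕ => μ) ≤
      K ^ 2 * ∑ j ∈ S, ‖v j‖ ^ 2 := by
  have hint : ∀ i j, Integrable (fun z : ℕ → X => ξ (z i) * ξ (z j))
      (Measure.infinitePi fun _ : ℕ => μ) := fun i j => by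
    refine Integrable.of_bound ((hξ.comp (measurable_pi_apply i)).mul
      (hξ.comp (measurable_pi_apply j))).aestronglyMeasurable (K * K)
      (Filter.Eventually.of_forall fun z => ?_)
    rw [Real.norm_eq_abs, abs_mul]
    exact mul_le_mul (hK _) (hK _) (abs_nonneg _) ((abs_nonneg _).trans (hK (z i)))
  have hexp : ∀ z : ℕ → X, ‖∑ j ∈ S, ξ (z j) • v j‖ ^ 2 =
      ∑ i ∈ S, ∑ j ∈ S, ξ (z i) * ξ (z j) * inner ℝ (v i) (v j) := fun z => by
    rw [← real_inner_self_eq_norm_sq, sum_inner]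
    refine Finset.sum_congr rfl fun i _ => ?_
    rw [inner_sum]
    refine Finset.sum_congr rfl fun j _ => ?_
    rw [real_inner_smul_left, real_inner_smul_right, mul_assoc]
  simp only [hexp]
  rw [integral_finsetSum _ fun i _ => integrable_finsetSum _ fun j _ => (hint i j).mul_const _,
    Finset.mul_sum]
  refine Finset.sum_le_sum fun i hi => ?_
  rw [integral_finsetSum _ fun j _ => (hint i j).mul_const _, Finset.sum_eq_single i]
  · rw [integral_mul_const, real_inner_self_eq_norm_sq]
    gcongr
    calc ∫ z : ℕ → X, ξ (z i) * ξ (z i) ∂(Measure.infinitePi fun _ : ℕ => μ)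
        ≤ ∫ z : ℕ → X, K ^ 2 ∂(Measure.infinitePi fun _ : ℕ => μ) :=
          integral_mono (hint i i) (integrable_const _) fun z => by
            have := sq_le_sq' (abs_le.1 (hK (z i))).1 (abs_le.1 (hK (z i))).2
            simpa [sq] using this
      _ = K ^ 2 := by simp
  · intro j _ hj
    rw [integral_mul_const, integral_comp_eval_mul hξ hK h0 hj.symm, zero_mul]
  · exact fun h => absurd hi h

lemma integral_norm_sq_tsum_smul_le [CompleteSpace F] {ξ : X → ℝ} (hξ : Measurable ξ) {K : ℝ}
    (hK : ∀ t, |ξ t| ≤ K) (hK0 : 0 ≤ K) (h0 : ∫ t, ξ t ∂μ = 0) {v : ℕ → F}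
    (hv : Summable fun j => ‖v j‖) (hv2 : Summable fun j => ‖v j‖ ^ 2) :
    ∫ z : ℕ → X, ‖∑' j, ξ (z j) • v j‖ ^ 2 ∂(Measure.infinitePi fun _ : ℕ => μ) ≤
      K ^ 2 * ∑' j, ‖v j‖ ^ 2 := by
  have hlim := tendsto_integral_of_dominated_convergence
    (μ := Measure.infinitePi fun _ : ℕ => μ)
    (F := fun n (z : ℕ → X) => ‖∑ j ∈ Finset.range n, ξ (z j) • v j‖ ^ 2)
    (f := fun z => ‖∑' j, ξ (z j) • v j‖ ^ 2) (fun _ => (K * ∑' j, ‖v j‖) ^ 2)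
    (fun n => ((stronglyMeasurable_sum_smul hξ v _).norm.pow 2).aestronglyMeasurable)
    (integrable_const _)
    (fun n => Filter.Eventually.of_forall fun z => by
      rw [norm_pow, norm_norm]
      gcongr
      exact norm_sum_range_smul_le_of_bound hK hK0 hv z n)
    (Filter.Eventually.of_forall fun z =>
      (summable_smul_of_bound hK hv z).hasSum.tendsto_sum_nat.norm.pow 2)
  refine le_of_tendsto hlim (Filter.Eventually.of_forall fun n => ?_)
  refine (integral_norm_sq_sum_smul_le hξ hK h0 v _).trans ?_
  gcongr
  exact hv2.sum_le_tsum _ fun j _ => by positivity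

end RandomSeries

/-! ### Sequences in `ℓ^p` -/

/-- Stechkin's estimate for the square-summed tail of a decreasing sequence in `ℓ^p`. -/
lemma tsum_tail_sq_le {b : ℕ → ℝ} (hb0 : ∀ j, 0 ≤ b j) (hb : Antitone b) {p : ℝ} (hp0 : 0 < p)
    (hp1 : p < 1) (hbp : Summable fun j => b j ^ p) {s : ℕ} (hs : 1 ≤ s) :
    (Summable fun j => (if j < s then 0 else b j) ^ 2) ∧
    ∑' j, (if j < s then 0 else b j) ^ 2 ≤
      (∑' j, b j ^ p) ^ (2 / p) * (s : ℝ) ^ (-(2 / p - 1)) := by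
  set S := ∑' j, b j ^ p with hS
  have hS0 : 0 ≤ S := tsum_nonneg fun j => Real.rpow_nonneg (hb0 j) _
  have hs0 : (0 : ℝ) < s := by exact_mod_cast hs
  -- Indices start at `0`, so exactly `s` terms precede `b s`, each at least as large.
  have h1 : b s ^ p ≤ S / s := by
    rw [le_div_iff₀ hs0, mul_comm]
    calc (s : ℝ) * b s ^ p = ∑ j ∈ Finset.range s, b s ^ p := by simp
      _ ≤ ∑ j ∈ Finset.range s, b j ^ p := Finset.sum_le_sum fun j hj =>
          Real.rpow_le_rpow (hb0 s) (hb (Finset.mem_range.1 hj).le) hp0.le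
      _ ≤ S := hbp.sum_le_tsum _ fun j _ => Real.rpow_nonneg (hb0 j) _
  have h2 : b s ^ (2 - p) ≤ (S / s) ^ ((2 - p) / p) := by
    have := Real.rpow_le_rpow (Real.rpow_nonneg (hb0 s) _) h1
      (show 0 ≤ (2 - p) / p by apply div_nonneg <;> linarith)
    rwa [← Real.rpow_mul (hb0 s), mul_div_cancel₀ _ hp0.ne'] at this
  -- In the tail, `b j ^ 2 = b j ^ (2 - p) * b j ^ p`; the first factor is at most its value at `s`,
  -- the second is summable.
  have h3 : ∀ j, (if j < s then 0 else b j) ^ 2 ≤ (S / s) ^ ((2 - p) / p) * b j ^ p := fun j => by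
    have hnn : 0 ≤ (S / s) ^ ((2 - p) / p) * b j ^ p :=
      mul_nonneg (by positivity) (Real.rpow_nonneg (hb0 j) _)
    split_ifs with hj
    · simpa using hnn
    · calc b j ^ 2 = b j ^ (2 - p) * b j ^ p := by
            rw [← Real.rpow_add_of_nonneg (hb0 j) (by linarith) hp0.le]
            norm_num
        _ ≤ (S / s) ^ ((2 - p) / p) * b j ^ p := by
            refine mul_le_mul_of_nonneg_right (le_trans ?_ h2) (Real.rpow_nonneg (hb0 j) _)
            exact Real.rpow_le_rpow (hb0 j) (hb (not_lt.1 hj)) (by linarith)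
  have hsum : Summable fun j => (if j < s then 0 else b j) ^ 2 :=
    Summable.of_nonneg_of_le (fun j => sq_nonneg _) h3 (hbp.mul_left _)
  refine ⟨hsum, (hsum.tsum_le_tsum h3 (hbp.mul_left _)).trans_eq ?_⟩
  have he : (2 - p) / p = 2 / p - 1 := by field_simp
  have hpos : 0 < 2 / p - 1 := by rw [← he]; apply div_pos <;> linarith
  rw [tsum_mul_left, ← hS, he, Real.div_rpow hS0 hs0.le, Real.rpow_neg hs0.le,
    div_mul_eq_mul_div, div_eq_mul_inv]
  congr 1
  nth_rewrite 2 [← Real.rpow_one S]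
  rw [← Real.rpow_add_of_nonneg hS0 hpos.le zero_le_one]
  congr 1
  ring

/-! ### Coercive variational problems with random coefficient operators -/

section Variational

variable {H F : Type*} [NormedAddCommGroup H] [InnerProductSpace ℝ H]
  [NormedAddCommGroup F] [InnerProductSpace ℝ F]

/-- `v` solves the variational problem `⟪A (G v), G φ⟫ = q φ` for all `φ`. -/
def IsVariationalSolution (G : H →L[ℝ] F) (q : StrongDual ℝ H) (A : F →L[ℝ] F) (v : H) : Prop :=
  ∀ φ : H, inner ℝ (A (G v)) (G φ) = q φ

/-- Testing with the solution itself gives `α ‖G v‖² ≤ q v ≤ N ‖G v‖`. -/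
lemma IsVariationalSolution.norm_le {G : H →L[ℝ] F} {q : StrongDual ℝ H} {A : F →L[ℝ] F} {v : H}
    (h : IsVariationalSolution G q A v) {α : ℝ} (hα : 0 < α)
    (hA : ∀ g, α * ‖g‖ ^ 2 ≤ inner ℝ (A g) g) {N : ℝ} (hN0 : 0 ≤ N)
    (hN : ∀ v, |q v| ≤ N * ‖G v‖) : ‖G v‖ ≤ N / α := by
  have h1 := (hA (G v)).trans_eq (h v)
  have h2 := h1.trans ((le_abs_self _).trans (hN v))
  rcases (norm_nonneg (G v)).eq_or_lt with h0 | h0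
  · rw [← h0]; positivity
  · rw [le_div_iff₀ hα]
    refine le_of_mul_le_mul_right ?_ h0
    linarith

/-- Perturbation of the coefficient operator. -/
lemma IsVariationalSolution.norm_sub_le {G : H →L[ℝ] F} {q : StrongDual ℝ H} {A B : F →L[ℝ] F}
    {v w : H} (hv : IsVariationalSolution G q A v) (hw : IsVariationalSolution G q B w) {α : ℝ}
    (hα : 0 < α) (hA : ∀ g, α * ‖g‖ ^ 2 ≤ inner ℝ (A g) g) :
    ‖G (v - w)‖ ≤ ‖(A - B) (G w)‖ / α := by
  have h1 := hA (G (v - w))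
  -- Both equations are tested with `v - w`. The residual contains `w` and not `v`: with the
  -- truncated solution as `w`, it is a product of independent factors.
  have h2 : inner ℝ (A (G (v - w))) (G (v - w)) = -inner ℝ ((A - B) (G w)) (G (v - w)) := by
    have e1 := hv (v - w)
    have e2 := hw (v - w)
    rw [sub_apply, inner_sub_left, e2]
    conv_lhs => rw [map_sub G, map_sub A, inner_sub_left, ← map_sub, e1]
    ring
  have h3 := (h2 ▸ h1).trans (neg_le_abs _) |>.trans (abs_real_inner_le_norm _ _)
  rcases (norm_nonneg (G (v - w))).eq_or_lt with h0 | h0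
  · rw [← h0]; positivity
  · rw [le_div_iff₀ hα]
    refine le_of_mul_le_mul_right ?_ h0
    linarith

variable [CompleteSpace H] [CompleteSpace F]

/-- The operator on `H` representing the bilinear form `(v, φ) ↦ ⟪A (G v), G φ⟫`. -/
noncomputable def formOperator (G : H →L[ℝ] F) : (F →L[ℝ] F) →L[ℝ] (H →L[ℝ] H) :=
  (ContinuousLinearMap.compL ℝ H F H (ContinuousLinearMap.adjoint G)).comp
    ((ContinuousLinearMap.compL ℝ H F F).flip G)

lemma inner_formOperator (G : H →L[ℝ] F) (A : F →L[ℝ] F) (v φ : H) :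
    inner ℝ (formOperator G A v) φ = inner ℝ (A (G v)) (G φ) := by
  simp [formOperator, ContinuousLinearMap.adjoint_inner_left]

/-- The solution operator of the variational problem. -/
noncomputable def variationalSolution (G : H →L[ℝ] F) (q : StrongDual ℝ H) (A : F →L[ℝ] F) : H :=
  Ring.inverse (formOperator G A) ((InnerProductSpace.toDual ℝ H).symm q)

lemma isVariationalSolution_iff_formOperator (G : H →L[ℝ] F) (q : StrongDual ℝ H)
    (A : F →L[ℝ] F) (v : H) : IsVariationalSolution G q A v ↔
      formOperator G A v = (InnerProductSpace.toDual ℝ H).symm q := by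
  constructor
  · intro h
    refine ext_inner_right ℝ fun φ => ?_
    rw [inner_formOperator, h φ, InnerProductSpace.toDual_symm_apply]
  · intro h φ
    rw [← inner_formOperator, h, InnerProductSpace.toDual_symm_apply]

/-- Lax–Milgram: the form is coercive on `H` with constant `α / c ^ 2`. -/
lemma isUnit_formOperator {G : H →L[ℝ] F} {c : ℝ} (hc0 : 0 < c) (hG : ∀ v, ‖v‖ ≤ c * ‖G v‖)
    {α : ℝ} (hα : 0 < α) {A : F →L[ℝ] F} (hA : ∀ g, α * ‖g‖ ^ 2 ≤ inner ℝ (A g) g) :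
    IsUnit (formOperator G A) := by
  refine ContinuousLinearMap.isUnit_of_forall_le_norm_inner_map _
    (c := ⟨α / c ^ 2, by positivity⟩) (by change 0 < α / c ^ 2; positivity) fun x => ?_
  rw [inner_formOperator]
  refine le_trans ?_ ((hA (G x)).trans (le_abs_self _))
  change ‖x‖ ^ 2 * (α / c ^ 2) ≤ _
  rw [mul_div_assoc', div_le_iff₀ (by positivity)]
  have : ‖x‖ ^ 2 ≤ c ^ 2 * ‖G x‖ ^ 2 := by
    rw [← mul_pow]
    gcongr
    exact hG x
  nlinarith

lemma isVariationalSolution_iff {G : H →L[ℝ] F} {A : F →L[ℝ] F}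
    (hA : IsUnit (formOperator G A)) (q : StrongDual ℝ H) (v : H) :
    IsVariationalSolution G q A v ↔ v = variationalSolution G q A := by
  rw [isVariationalSolution_iff_formOperator, variationalSolution]
  constructor
  · intro h
    rw [← h, ← mul_apply_eq_comp, Ring.inverse_mul_cancel _ hA]
    rfl
  · intro h
    rw [h, ← mul_apply_eq_comp, Ring.mul_inverse_cancel _ hA]
    rfl

lemma existsUnique_isVariationalSolution {G : H →L[ℝ] F} {A : F →L[ℝ] F}
    (hA : IsUnit (formOperator G A)) (q : StrongDual ℝ H) :
    ∃! v, IsVariationalSolution G q A v := by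
  simp only [isVariationalSolution_iff hA q, existsUnique_eq]

/-- `Ring.inverse` is continuous on the open set of units and constantly `0` off it, hence Borel.
The algebra need not be separable, so separability of the range is proved apart, from that of the
range of `f`. -/
lemma stronglyMeasurable_ringInverse_comp {Ω R : Type*} [MeasurableSpace Ω] [NormedRing R]
    [HasSummableGeomSeries R] {f : Ω → R} (hf : StronglyMeasurable f) :
    StronglyMeasurable fun y => Ring.inverse (f y) := by
  classical
  borelize R
  have hU : MeasurableSet {x : R | IsUnit x} := Units.isOpen.measurableSet
  have hcont : ContinuousOn Ring.inverse {x : R | IsUnit x} := fun x hx => by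
    obtain ⟨u, rfl⟩ := hx
    exact (NormedRing.inverse_continuousAt u).continuousWithinAt
  have hmeas : Measurable (Ring.inverse : R → R) := by
    refine measurable_of_restrict_of_restrict_compl hU hcont.domRestrict.measurable ?_
    have : Set.domRestrict {x : R | IsUnit x}ᶜ Ring.inverse = fun _ => (0 : R) := by
      ext x
      exact Ring.inverse_non_unit _ x.2
    rw [this]
    exact measurable_const
  rw [stronglyMeasurable_iff_measurable_separable]
  refine ⟨hmeas.comp hf.measurable, ?_⟩
  have hsep := hf.isSeparable_range
  have h1 : IsSeparable (Ring.inverse '' (Set.range f ∩ {x : R | IsUnit x})) := by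
    have h2 : IsSeparable (Set.range f ∩ {x : R | IsUnit x}) := hsep.mono Set.inter_subset_left
    have := h2.separableSpace
    rw [Set.image_eq_range]
    exact isSeparable_range (hcont.mono Set.inter_subset_right).domRestrict
  refine (h1.union (Set.finite_singleton (0 : R)).isSeparable).mono ?_
  rintro _ ⟨y, rfl⟩
  by_cases hy : IsUnit (f y)
  · exact Or.inl ⟨f y, ⟨⟨y, rfl⟩, hy⟩, rfl⟩
  · exact Or.inr (Ring.inverse_non_unit _ hy)

lemma stronglyMeasurable_variationalSolution {Ω : Type*} [MeasurableSpace Ω] (G : H →L[ℝ] F)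
    (q : StrongDual ℝ H) {A : Ω → F →L[ℝ] F} (hA : StronglyMeasurable A) :
    StronglyMeasurable fun y => variationalSolution G q (A y) :=
  (ContinuousLinearMap.apply ℝ H _).continuous.comp_stronglyMeasurable
    (stronglyMeasurable_ringInverse_comp ((formOperator G).continuous.comp_stronglyMeasurable hA))

/-! ### Affine random operators, their truncations and the truncation error. -/

variable {X : Type*}

/-- The terms with index at least `s`. -/
def tailFrom {E : Type*} [Zero E] (s : ℕ) (v : ℕ → E) : ℕ → E := fun j => if j < s then 0 else v j

lemma norm_tailFrom {E : Type*} [NormedAddCommGroup E] (s : ℕ) (v : ℕ → E) (j : ℕ) :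
    ‖tailFrom s v j‖ = if j < s then 0 else ‖v j‖ := by
  unfold tailFrom
  split_ifs <;> simp

lemma summable_norm_tailFrom {E : Type*} [NormedAddCommGroup E] (s : ℕ) {v : ℕ → E}
    (hv : Summable fun j => ‖v j‖) : Summable fun j => ‖tailFrom s v j‖ :=
  Summable.of_nonneg_of_le (fun j => norm_nonneg _)
    (fun j => by rw [norm_tailFrom]; split_ifs <;> simp) hv

/-- The affine coefficient operator `A₀ + ∑ j, ξ (y j) • A j`. -/
noncomputable def affineOperator {E : Type*} [NormedAddCommGroup E] [NormedSpace ℝ E]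
    (A₀ : E) (A : ℕ → E) (ξ : X → ℝ) (y : ℕ → X) : E :=
  A₀ + ∑' j, ξ (y j) • A j

/-- The truncated affine coefficient operator. -/
noncomputable def truncAffineOperator {E : Type*} [NormedAddCommGroup E] [NormedSpace ℝ E]
    (A₀ : E) (A : ℕ → E) (ξ : X → ℝ) (s : ℕ) (y : ℕ → X) : E :=
  A₀ + ∑ j ∈ Finset.range s, ξ (y j) • A j

section Affine

variable {E : Type*} [NormedAddCommGroup E] [NormedSpace ℝ E]

lemma affineOperator_eq_add_tail [CompleteSpace E] (A₀ : E) {A : ℕ → E}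
    (hA : Summable fun j => ‖A j‖) {ξ : X → ℝ} {K : ℝ} (hK : ∀ t, |ξ t| ≤ K) (s : ℕ) (y : ℕ → X) :
    affineOperator A₀ A ξ y = truncAffineOperator A₀ A ξ s y + ∑' j, ξ (y j) • tailFrom s A j := by
  have h1 : ∑ j ∈ Finset.range s, ξ (y j) • A j =
      ∑' j, if j ∈ Finset.range s then ξ (y j) • A j else 0 := by
    rw [tsum_eq_sum (s := Finset.range s) fun j hj => if_neg hj]
    exact Finset.sum_congr rfl fun j hj => (if_pos hj).symm
  rw [affineOperator, truncAffineOperator, add_assoc, h1, ← Summable.tsum_add]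
  · congr 2
    ext j
    by_cases hj : j < s <;> simp [tailFrom, hj]
  · exact summable_of_ne_finset_zero (s := Finset.range s) fun j hj => if_neg hj
  · exact summable_smul_of_bound hK (summable_norm_tailFrom s hA) y

/-- On a glued sequence the truncated operator sees only the first argument and, by
`tsum_tailFrom_glueAt`, the remainder only the second. -/
lemma truncAffineOperator_glueAt (A₀ : E) (A : ℕ → E) (ξ : X → ℝ) (s : ℕ)
    (y : (ℕ → X) × (ℕ → X)) :
    truncAffineOperator A₀ A ξ s (glueAt s y) = truncAffineOperator A₀ A ξ s y.1 := by
  unfold truncAffineOperator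
  congr 1
  refine Finset.sum_congr rfl fun j hj => ?_
  rw [glueAt, if_pos (Finset.mem_range.1 hj)]

lemma tsum_tailFrom_glueAt (A : ℕ → E) (ξ : X → ℝ) (s : ℕ) (y : (ℕ → X) × (ℕ → X)) :
    ∑' j, ξ (glueAt s y j) • tailFrom s A j = ∑' j, ξ (y.2 j) • tailFrom s A j := by
  congr 1
  ext j
  by_cases hj : j < s <;> simp [tailFrom, glueAt, hj]

variable [MeasurableSpace X]

lemma stronglyMeasurable_affineOperator [CompleteSpace E] (A₀ : E) {A : ℕ → E}
    (hA : Summable fun j => ‖A j‖) {ξ : X → ℝ} (hξ : Measurable ξ) {K : ℝ}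
    (hK : ∀ t, |ξ t| ≤ K) : StronglyMeasurable (affineOperator A₀ A ξ) :=
  stronglyMeasurable_const.add (stronglyMeasurable_tsum_smul hξ hK hA)

lemma stronglyMeasurable_truncAffineOperator (A₀ : E) (A : ℕ → E) {ξ : X → ℝ} (hξ : Measurable ξ)
    (s : ℕ) : StronglyMeasurable (truncAffineOperator A₀ A ξ s) :=
  stronglyMeasurable_const.add (stronglyMeasurable_sum_smul hξ A _)

end Affine

variable [MeasurableSpace X] {μ : Measure X} [IsProbabilityMeasure μ]

variable {A₀ : F →L[ℝ] F} {A : ℕ → F →L[ℝ] F} {ξ : X → ℝ} {K α : ℝ}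

/-- Truncation preserves coercivity, since it is a conditional expectation. -/
lemma ae_coercive_truncAffineOperator (hA : Summable fun j => ‖A j‖) (hξ : Measurable ξ)
    (hK : ∀ t, |ξ t| ≤ K) (h0 : ∫ t, ξ t ∂μ = 0)
    (hco : ∀ᵐ y ∂(Measure.infinitePi fun _ : ℕ => μ), ∀ g,
      α * ‖g‖ ^ 2 ≤ inner ℝ (affineOperator A₀ A ξ y g) g) (s : ℕ) :
    ∀ᵐ y ∂(Measure.infinitePi fun _ : ℕ => μ), ∀ g,
      α * ‖g‖ ^ 2 ≤ inner ℝ (truncAffineOperator A₀ A ξ s y g) g := by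
  -- For almost every head `y`, coercivity holds for almost every tail `z`; integrating over `z`
  -- removes the centred remainder.
  have h1 := Measure.ae_ae_of_ae_prod ((measurePreserving_glueAt s).quasiMeasurePreserving.ae hco)
  filter_upwards [h1] with y hy g
  have hAs := summable_norm_tailFrom s hA
  have hint : Integrable (fun z : ℕ → X => ∑' j, ξ (z j) • tailFrom s A j)
      (Measure.infinitePi fun _ : ℕ => μ) :=
    Integrable.of_bound (stronglyMeasurable_tsum_smul hξ hK hAs).aestronglyMeasurable _
      (Filter.Eventually.of_forall (norm_tsum_smul_le_of_bound hK hAs))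
  let L : (F →L[ℝ] F) →L[ℝ] ℝ := (innerSL ℝ g).comp (ContinuousLinearMap.apply ℝ F g)
  have hL : ∀ B : F →L[ℝ] F, L B = inner ℝ (B g) g := fun B => real_inner_comm _ _
  have hint2 := L.integrable_comp hint
  calc α * ‖g‖ ^ 2 = ∫ z : ℕ → X, α * ‖g‖ ^ 2 ∂(Measure.infinitePi fun _ : ℕ => μ) := by simp
    _ ≤ ∫ z : ℕ → X, (L (truncAffineOperator A₀ A ξ s y) + L (∑' j, ξ (z j) • tailFrom s A j))
          ∂(Measure.infinitePi fun _ : ℕ => μ) := by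
        refine integral_mono_ae (integrable_const _) ((integrable_const _).add hint2) ?_
        filter_upwards [hy] with z hz
        have := hz g
        rwa [affineOperator_eq_add_tail A₀ hA hK s, truncAffineOperator_glueAt,
          tsum_tailFrom_glueAt, ← hL, map_add] at this
    _ = inner ℝ (truncAffineOperator A₀ A ξ s y g) g := by
        rw [integral_add (integrable_const _) hint2, L.integral_comp_comm hint,
          integral_tsum_smul_eq_zero hξ hK h0 hAs, map_zero, add_zero, ← hL]
        simp

/-- Any a.e. choice of solutions agrees a.e. with the measurable solution operator and obeys the
uniform a priori bound. -/
lemma memLp_variationalSolution {G : H →L[ℝ] F} {c : ℝ} (hc0 : 0 < c)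
    (hG : ∀ v, ‖v‖ ≤ c * ‖G v‖) (hα : 0 < α) {Ω : Type*} [MeasurableSpace Ω] {P : Measure Ω}
    [IsFiniteMeasure P] {B : Ω → F →L[ℝ] F} (hB : StronglyMeasurable B)
    (hco : ∀ᵐ y ∂P, ∀ g, α * ‖g‖ ^ 2 ≤ inner ℝ (B y g) g)
    {q : StrongDual ℝ H} {N : ℝ} (hN0 : 0 ≤ N) (hN : ∀ v, |q v| ≤ N * ‖G v‖) {u : Ω → H}
    (hu : ∀ᵐ y ∂P, IsVariationalSolution G q (B y) (u y)) (p : ℝ≥0∞) : MemLp u p P := by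
  refine MemLp.of_bound ⟨_, stronglyMeasurable_variationalSolution G q hB, ?_⟩ (c * (N / α)) ?_
  · filter_upwards [hu, hco] with y hy hcy
    exact (isVariationalSolution_iff (isUnit_formOperator hc0 hG hα hcy) q _).1 hy
  · filter_upwards [hu, hco] with y hy hcy
    refine (hG _).trans ?_
    gcongr
    exact hy.norm_le hα hcy hN0 hN

set_option maxHeartbeats 1000000 in
/-- The truncation error in the mean square sense. -/
lemma integral_norm_sq_sub_le {G : H →L[ℝ] F} {c : ℝ} (hc0 : 0 < c)
    (hG : ∀ v, ‖v‖ ≤ c * ‖G v‖) (hα : 0 < α) (hA : Summable fun j => ‖A j‖) (hξ : Measurable ξ)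
    (hK : ∀ t, |ξ t| ≤ K) (hK0 : 0 ≤ K) (h0 : ∫ t, ξ t ∂μ = 0)
    (hco : ∀ᵐ y ∂(Measure.infinitePi fun _ : ℕ => μ), ∀ g,
      α * ‖g‖ ^ 2 ≤ inner ℝ (affineOperator A₀ A ξ y g) g) (s : ℕ)
    {b : ℕ → ℝ} (hb : ∀ j, ‖A j‖ ≤ b j)
    (hb2 : Summable fun j => (if j < s then 0 else b j) ^ 2)
    {q : StrongDual ℝ H} {N : ℝ} (hN0 : 0 ≤ N) (hN : ∀ v, |q v| ≤ N * ‖G v‖)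
    {u us : (ℕ → X) → H}
    (hu : ∀ᵐ y ∂(Measure.infinitePi fun _ : ℕ => μ),
      IsVariationalSolution G q (affineOperator A₀ A ξ y) (u y))
    (hus : ∀ᵐ y ∂(Measure.infinitePi fun _ : ℕ => μ),
      IsVariationalSolution G q (truncAffineOperator A₀ A ξ s y) (us y)) :
    ∫ y, ‖G (u y - us y)‖ ^ 2 ∂(Measure.infinitePi fun _ : ℕ => μ) ≤
      (K * N / α ^ 2) ^ 2 * ∑' j, (if j < s then 0 else b j) ^ 2 := by
  set P := Measure.infinitePi fun _ : ℕ => μ with hP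
  have hcos := ae_coercive_truncAffineOperator hA hξ hK h0 hco s
  have hmA := stronglyMeasurable_affineOperator A₀ hA hξ hK
  have hmAs := stronglyMeasurable_truncAffineOperator A₀ A hξ s
  have hAs := summable_norm_tailFrom s hA
  have hmu := memLp_variationalSolution hc0 hG hα hmA hco hN0 hN hu 2
  have hmus := memLp_variationalSolution hc0 hG hα hmAs hcos hN0 hN hus 2
  -- A version of `us` that is measurable and depends on the first `s` coordinates everywhere,
  -- whereas `us` is only determined a.e.
  let w : (ℕ → X) → H := fun y => variationalSolution G q (truncAffineOperator A₀ A ξ s y)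
  have hw : StronglyMeasurable w := stronglyMeasurable_variationalSolution G q hmAs
  let R : (ℕ → X) → F →L[ℝ] F := fun z => ∑' j, ξ (z j) • tailFrom s A j
  have hR : StronglyMeasurable R := stronglyMeasurable_tsum_smul hξ hK hAs
  have hwb : ∀ᵐ y ∂P, ‖G (w y)‖ ≤ N / α := by
    filter_upwards [hcos] with y hcy
    exact ((isVariationalSolution_iff (isUnit_formOperator hc0 hG hα hcy) q _).2 rfl).norm_le
      hα hcy hN0 hN
  have hmeas : StronglyMeasurable fun y : (ℕ → X) × (ℕ → X) => ‖R y.2 (G (w y.1))‖ ^ 2 := by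
    have h1 : StronglyMeasurable fun y : (ℕ → X) × (ℕ → X) => (R y.2, G (w y.1)) :=
      (hR.comp_measurable measurable_snd).prodMk
        (G.continuous.comp_stronglyMeasurable (hw.comp_measurable measurable_fst))
    exact ((isBoundedBilinearMap_apply.continuous.comp_stronglyMeasurable h1).norm.pow 2)
  have hRb : ∀ z, ‖R z‖ ≤ K * ∑' j, ‖tailFrom s A j‖ := norm_tsum_smul_le_of_bound hK hAs
  have hint : Integrable (fun y : (ℕ → X) × (ℕ → X) => ‖R y.2 (G (w y.1))‖ ^ 2) (P.prod P) := by
    refine Integrable.of_bound hmeas.aestronglyMeasurable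
      (((K * ∑' j, ‖tailFrom s A j‖) * (N / α)) ^ 2) ?_
    filter_upwards [Measure.quasiMeasurePreserving_fst.ae hwb] with y hy
    rw [norm_pow, norm_norm]
    gcongr
    exact ((R y.2).le_opNorm _).trans (mul_le_mul (hRb _) hy (norm_nonneg _)
      ((norm_nonneg _).trans (hRb y.2)))
  have hglue : ∀ y : (ℕ → X) × (ℕ → X),
      ‖R (glueAt s y) (G (w (glueAt s y)))‖ ^ 2 = ‖R y.2 (G (w y.1))‖ ^ 2 := fun y => by
    simp only [R, w, truncAffineOperator_glueAt, tsum_tailFrom_glueAt]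
  have hdiag : StronglyMeasurable fun y : ℕ → X => ‖R y (G (w y))‖ ^ 2 :=
    hmeas.comp_measurable (measurable_id.prodMk measurable_id)
  have hmp := measurePreserving_glueAt (μ := μ) s
  have hint_diag : Integrable (fun y : ℕ → X => ‖R y (G (w y))‖ ^ 2) P := by
    rw [← hmp.integrable_comp hdiag.aestronglyMeasurable]
    exact hint.congr (Filter.Eventually.of_forall fun y => (hglue y).symm)
  -- Change of variables by `glueAt`, then Fubini: the remainder `R` and the solution `w` now have
  -- separate variables.
  have hsplit : ∫ y, ‖R y (G (w y))‖ ^ 2 ∂P = ∫ y, ∫ z, ‖R z (G (w y))‖ ^ 2 ∂P ∂P := by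
    rw [← integral_prod _ hint]
    conv_lhs => rw [hP, ← hmp.map_eq]
    rw [integral_map hmp.measurable.aemeasurable hdiag.aestronglyMeasurable]
    simp only [hglue, hP]
  -- Orthogonality needs vectors in a Hilbert space, so the operators are first evaluated at a fixed
  -- `g`.
  have hinner : ∀ g : F, ∫ z, ‖R z g‖ ^ 2 ∂P ≤
      K ^ 2 * ((∑' j, (if j < s then 0 else b j) ^ 2) * ‖g‖ ^ 2) := fun g => by
    have hle : ∀ j, ‖tailFrom s A j g‖ ^ 2 ≤ (if j < s then 0 else b j) ^ 2 * ‖g‖ ^ 2 :=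
      fun j => by
        rw [← mul_pow]
        gcongr
        refine ((tailFrom s A j).le_opNorm g).trans ?_
        gcongr
        rw [norm_tailFrom]
        split_ifs
        · exact le_rfl
        · exact hb j
    have hs1 : Summable fun j => ‖tailFrom s A j g‖ :=
      Summable.of_nonneg_of_le (fun j => norm_nonneg _)
        (fun j => (tailFrom s A j).le_opNorm g) (hAs.mul_right _)
    have hs2 : Summable fun j => ‖tailFrom s A j g‖ ^ 2 :=
      Summable.of_nonneg_of_le (fun j => by positivity) hle (hb2.mul_right _)
    have hRg : ∀ z, R z g = ∑' j, ξ (z j) • tailFrom s A j g := fun z =>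
      (ContinuousLinearMap.apply ℝ F g).map_tsum (summable_smul_of_bound hK hAs z)
    simp only [hRg]
    refine (integral_norm_sq_tsum_smul_le hξ hK hK0 h0 hs1 hs2).trans ?_
    rw [← tsum_mul_right]
    exact mul_le_mul_of_nonneg_left (hs2.tsum_le_tsum hle (hb2.mul_right _)) (sq_nonneg K)
  have hT0 : 0 ≤ ∑' j, (if j < s then 0 else b j) ^ 2 := tsum_nonneg fun j => sq_nonneg _
  have hmain : ∫ y, ‖R y (G (w y))‖ ^ 2 ∂P ≤
      K ^ 2 * ((∑' j, (if j < s then 0 else b j) ^ 2) * (N / α) ^ 2) := by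
    rw [hsplit]
    calc ∫ y, ∫ z, ‖R z (G (w y))‖ ^ 2 ∂P ∂P
        ≤ ∫ _, K ^ 2 * ((∑' j, (if j < s then 0 else b j) ^ 2) * (N / α) ^ 2) ∂P := by
          refine integral_mono_ae hint.integral_prod_left (integrable_const _) ?_
          filter_upwards [hwb] with y hy
          refine (hinner _).trans ?_
          gcongr
      _ = _ := by simp
  calc ∫ y, ‖G (u y - us y)‖ ^ 2 ∂P ≤ ∫ y, ‖R y (G (w y))‖ ^ 2 / α ^ 2 ∂P := by
        refine integral_mono_ae ?_ (hint_diag.div_const _) ?_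
        · exact (G.comp_memLp' (hmu.sub hmus)).integrable_norm_pow (by simp)
        · filter_upwards [hu, hus, hco, hcos] with y hy hys hcy hcys
          have e1 := (isVariationalSolution_iff (isUnit_formOperator hc0 hG hα hcys) q _).1 hys
          have e2 := hy.norm_sub_le hys hα hcy
          rw [affineOperator_eq_add_tail A₀ hA hK s, add_sub_cancel_left, e1] at e2
          change _ ≤ ‖R y (G (w y))‖ ^ 2 / α ^ 2
          rw [← div_pow]
          have e3 : us y = w y := e1
          rw [e3]
          gcongr
    _ = (∫ y, ‖R y (G (w y))‖ ^ 2 ∂P) / α ^ 2 := integral_div _ _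
    _ ≤ K ^ 2 * ((∑' j, (if j < s then 0 else b j) ^ 2) * (N / α) ^ 2) / α ^ 2 := by gcongr
    _ = _ := by
        field_simp

end Variational

/-! ### Multiplication by essentially bounded functions and the diffusion problem -/

section Multiplication

variable {α E : Type*} [MeasurableSpace α] (μ : Measure α) [NormedAddCommGroup E]
  [InnerProductSpace ℝ E]

/-- Multiplication of square integrable functions by an essentially bounded function. -/
noncomputable def mulLp (E : Type*) [NormedAddCommGroup E] [InnerProductSpace ℝ E] :
    Lp ℝ ∞ μ →L[ℝ] Lp E 2 μ →L[ℝ] Lp E 2 μ :=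
  (ContinuousLinearMap.lsmul ℝ ℝ : ℝ →L[ℝ] E →L[ℝ] E).holderL μ ∞ 2 2

lemma coeFn_mulLp (a : Lp ℝ ∞ μ) (g : Lp E 2 μ) : mulLp μ E a g =ᵐ[μ] fun x => a x • g x :=
  ContinuousLinearMap.coeFn_holder _ a g

lemma norm_mulLp_le (a : Lp ℝ ∞ μ) : ‖mulLp μ E a‖ ≤ ‖a‖ := by
  refine ContinuousLinearMap.opNorm_le_bound _ (norm_nonneg _) fun g => ?_
  refine (ContinuousLinearMap.norm_holder_apply_apply_le _ a g).trans ?_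
  gcongr
  exact mul_le_of_le_one_left (norm_nonneg _) ContinuousLinearMap.opNorm_lsmul_le

lemma inner_mulLp (a : Lp ℝ ∞ μ) (g h : Lp E 2 μ) :
    inner ℝ (mulLp μ E a g) h = ∫ x, a x * inner ℝ (g x) (h x) ∂μ := by
  rw [L2.inner_def]
  refine integral_congr_ae ?_
  filter_upwards [coeFn_mulLp μ a g] with x hx
  rw [hx, real_inner_smul_left]

lemma mul_norm_sq_le_inner_mulLp {a : Lp ℝ ∞ μ} {c : ℝ} (hc : ∀ᵐ x ∂μ, c ≤ a x) (g : Lp E 2 μ) :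
    c * ‖g‖ ^ 2 ≤ inner ℝ (mulLp μ E a g) g := by
  rw [← real_inner_self_eq_norm_sq, ← real_inner_smul_left, L2.inner_def, L2.inner_def]
  refine integral_mono_ae (L2.integrable_inner _ _) (L2.integrable_inner _ _) ?_
  filter_upwards [coeFn_mulLp μ a g, Lp.coeFn_smul c g, hc] with x h1 h2 h3
  rw [h1, h2, Pi.smul_apply, real_inner_smul_left, real_inner_smul_left]
  gcongr
  exact real_inner_self_nonneg

end Multiplication

lemma ContinuousLinearMap.map_affineOperator {X E E' : Type*}
    [NormedAddCommGroup E] [NormedSpace ℝ E] [CompleteSpace E] [NormedAddCommGroup E']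
    [NormedSpace ℝ E'] (L : E →L[ℝ] E') (A₀ : E) {A : ℕ → E} (hA : Summable fun j => ‖A j‖)
    {ξ : X → ℝ} {K : ℝ} (hK : ∀ t, |ξ t| ≤ K) (y : ℕ → X) :
    L (affineOperator A₀ A ξ y) = affineOperator (L A₀) (fun j => L (A j)) ξ y := by
  rw [affineOperator, affineOperator, map_add, L.map_tsum (summable_smul_of_bound hK hA y)]
  simp only [map_smul]

lemma ContinuousLinearMap.map_truncAffineOperator {X E E' : Type*}
    [NormedAddCommGroup E] [NormedSpace ℝ E] [NormedAddCommGroup E']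
    [NormedSpace ℝ E'] (L : E →L[ℝ] E') (A₀ : E) (A : ℕ → E) (ξ : X → ℝ) (s : ℕ) (y : ℕ → X) :
    L (truncAffineOperator A₀ A ξ s y) = truncAffineOperator (L A₀) (fun j => L (A j)) ξ s y := by
  simp [truncAffineOperator]

/-- An essentially bounded function agrees a.e. with a bounded measurable function. -/
lemma MeasureTheory.MemLp.exists_measurable_bounded_ae_eq {α : Type*} [MeasurableSpace α]
    {μ : Measure α} {f : α → ℝ} (hf : MemLp f ∞ μ) :
    ∃ (g : α → ℝ) (K : ℝ), Measurable g ∧ 0 ≤ K ∧ (∀ t, |g t| ≤ K) ∧ f =ᵐ[μ] g := by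
  let m := hf.1.mk f
  have hm : Measurable m := hf.1.stronglyMeasurable_mk.measurable
  let K := lpNorm f ∞ μ
  have hK0 : 0 ≤ K := lpNorm_nonneg
  have hS : MeasurableSet {t | |m t| ≤ K} := measurableSet_le hm.abs measurable_const
  refine ⟨{t | |m t| ≤ K}.indicator m, K, hm.indicator hS, hK0, fun t => ?_, ?_⟩
  · by_cases h : t ∈ {t | |m t| ≤ K}
    · rw [Set.indicator_of_mem h]; exact h
    · rw [Set.indicator_of_notMem h]; simpa using hK0
  · filter_upwards [hf.1.ae_eq_mk, ae_le_lpNorm_exponent_top hf] with t h1 h2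
    have h : t ∈ {t | |m t| ≤ K} := by
      change |hf.1.mk f t| ≤ K
      rw [← h1]; exact h2
    rw [Set.indicator_of_mem h]
    exact h1

instance H01.instCompleteSpace {d : ℕ} (D : Opens (Space d)) : CompleteSpace (H01 D) :=
  (testGraph D).isClosed_topologicalClosure.completeSpace_coe

section Diffusion

variable {d : ℕ} {D : Opens (Space d)}

lemma isWeakSolution_iff {f : Space d → ℝ} {a : Lp ℝ ∞ (domainMeasure D)}
    (h : f =ᵐ[domainMeasure D] a) (q : Hminus1 D) (v : H01 D) :
    IsWeakSolution D f q v ↔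
      IsVariationalSolution (H01.gradL D) q (mulLp (domainMeasure D) (Space d) a) v := by
  refine forall_congr' fun φ => ?_
  rw [inner_mulLp]
  change ∫ x in (D : Set (Space d)), f x * inner ℝ (H01.grad v x) (H01.grad φ x) = q φ ↔
    ∫ x in (D : Set (Space d)), a x * inner ℝ (H01.grad v x) (H01.grad φ x) = q φ
  have : ∫ x in (D : Set (Space d)), f x * inner ℝ (H01.grad v x) (H01.grad φ x) =
      ∫ x in (D : Set (Space d)), a x * inner ℝ (H01.grad v x) (H01.grad φ x) := by
    refine integral_congr_ae ?_
    filter_upwards [h] with x hx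
    rw [hx]
  rw [this]

variable {a₀ : Space d → ℝ} {ψ : ℕ → Space d → ℝ} (ha₀ : MemLp a₀ ∞ (domainMeasure D))
  (hψ : ∀ j, MemLp (ψ j) ∞ (domainMeasure D))

/-- The series in `coeff` is pointwise in `x`, the one in `affineOperator` converges in `L_∞`;
summability of the norms identifies them a.e. -/
lemma coeff_ae_eq (hψ_sum : Summable fun j => LinftyNorm D (ψ j)) {ξ ζ : unitInterval → ℝ} {K : ℝ}
    (hK : ∀ t, |ζ t| ≤ K) {y : ParamSpace} (hy : ∀ j, ξ (y j) = ζ (y j)) :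
    coeff a₀ ψ ξ y =ᵐ[domainMeasure D]
      (affineOperator ha₀.toLp (fun j => (hψ j).toLp) ζ y : Lp ℝ ∞ (domainMeasure D)) := by
  have hs : Summable fun j => ‖(hψ j).toLp‖ := by
    simp only [Lp.norm_toLp]
    exact hψ_sum
  have hfin : ∑' j, ‖ζ (y j) • (hψ j).toLp‖ₑ ≠ ∞ :=
    tsum_enorm_ne_top_iff_summable_norm.2
      (Summable.of_nonneg_of_le (fun j => norm_nonneg _)
        (norm_smul_le_of_bound hK (fun j => (hψ j).toLp) y) (hs.mul_left K))
  filter_upwards [Lp.coeFn_add ha₀.toLp (∑' j, ζ (y j) • (hψ j).toLp), Lp.coeFn_tsum hfin,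
    ha₀.coeFn_toLp, ae_all_iff.2 fun j => Lp.coeFn_smul (ζ (y j)) (hψ j).toLp,
    ae_all_iff.2 fun j => (hψ j).coeFn_toLp] with x h1 h2 h3 h4 h5
  rw [affineOperator, h1, Pi.add_apply, h2, h3, coeff]
  simp only [h4, Pi.smul_apply, h5, hy, smul_eq_mul]

lemma truncCoeff_ae_eq {ξ ζ : unitInterval → ℝ} {y : ParamSpace}
    (hy : ∀ j, ξ (y j) = ζ (y j)) (s : ℕ) :
    truncCoeff a₀ ψ ξ s y =ᵐ[domainMeasure D]
      (truncAffineOperator ha₀.toLp (fun j => (hψ j).toLp) ζ s y : Lp ℝ ∞ (domainMeasure D)) := by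
  filter_upwards [Lp.coeFn_add ha₀.toLp (∑ j ∈ Finset.range s, ζ (y j) • (hψ j).toLp),
    Lp.coeFn_fun_finsetSum (Finset.range s) fun j => ζ (y j) • (hψ j).toLp,
    ha₀.coeFn_toLp, ae_all_iff.2 fun j => Lp.coeFn_smul (ζ (y j)) (hψ j).toLp,
    ae_all_iff.2 fun j => (hψ j).coeFn_toLp] with x h1 h2 h3 h4 h5
  rw [truncAffineOperator, h1, Pi.add_apply, h2, h3, truncCoeff]
  simp only [h4, Pi.smul_apply, h5, hy, smul_eq_mul]

end Diffusion

/-! ### The dimension truncation estimate for the diffusion problem. -/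

theorem mainTheorem6 {d : ℕ} (hd : 1 ≤ d) (D : Opens (Space d))
    (hDne : (D : Set (Space d)).Nonempty) (hDb : Bornology.IsBounded (D : Set (Space d)))
    (a₀ : Space d → ℝ) (ψ : ℕ → Space d → ℝ) (ξ : unitInterval → ℝ) (p amin amax : ℝ)
    (ha₀ : MemLp a₀ ∞ (domainMeasure D))
    (hψ : ∀ j, MemLp (ψ j) ∞ (domainMeasure D))
    (hψ_sum : Summable fun j => LinftyNorm D (ψ j))
    (hp0 : 0 < p) (hp1 : p < 1)
    (hψ_p : Summable fun j => LinftyNorm D (ψ j) ^ p)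
    (hψ_anti : Antitone fun j => LinftyNorm D (ψ j))
    (hξ : MemLp ξ ∞ volume) (hξ_mean : ∫ t, ξ t = 0)
    (hamin : 0 < amin)
    (hA2 : ∀ᵐ y ∂paramMeasure, ∀ᵐ x ∂domainMeasure D,
      amin ≤ coeff a₀ ψ ξ y x ∧ coeff a₀ ψ ξ y x ≤ amax) :
    -- the Poincaré constant is positive and the Poincaré inequality holds with it
    (0 < poincareConst D ∧ ∀ v : H01 D, ‖H01.val v‖ ≤ poincareConst D * ‖H01.grad v‖) ∧
    -- the problem and its truncations are uniquely solvable
    (∀ᵐ y ∂paramMeasure, ∀ q : Hminus1 D,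
      (∃! v : H01 D, IsWeakSolution D (coeff a₀ ψ ξ y) q v) ∧
      ∀ s : ℕ, ∃! v : H01 D, IsWeakSolution D (truncCoeff a₀ ψ ξ s y) q v) ∧
    -- the dimension truncation error
    ∃ C : ℝ, 0 < C ∧ ∀ (s : ℕ), 1 ≤ s → ∀ (q : Hminus1 D) (u us : ParamSpace → H01 D),
      (∀ᵐ y ∂paramMeasure, IsWeakSolution D (coeff a₀ ψ ξ y) q (u y)) →
      (∀ᵐ y ∂paramMeasure, IsWeakSolution D (truncCoeff a₀ ψ ξ s y) q (us y)) →
      MemLp u 2 paramMeasure ∧ MemLp us 2 paramMeasure ∧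
      √(∫ y, (∫ x in (D : Set (Space d)), (H01.val (u y - us y) x) ^ 2) ∂paramMeasure)
        ≤ poincareConst D *
          √(∫ y, (∫ x in (D : Set (Space d)), ‖H01.grad (u y - us y) x‖ ^ 2) ∂paramMeasure) ∧
      poincareConst D *
          √(∫ y, (∫ x in (D : Set (Space d)), ‖H01.grad (u y - us y) x‖ ^ 2) ∂paramMeasure)
        ≤ C * Hminus1Norm q * (s : ℝ) ^ (-(1 / p - 1 / 2)) := by
  have hcD := poincareConst_pos hd D hDne hDb
  have hpoinc := norm_val_le_poincareConst hd D hDb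
  obtain ⟨ζ, K, hζ, hK0, hK, hξζ⟩ := hξ.exists_measurable_bounded_ae_eq
  have hζ_mean : ∫ t, ζ t = 0 := by rw [← integral_congr_ae hξζ, hξ_mean]
  -- Countably many coordinates: almost every `y` avoids the exceptional null set in all of them at
  -- once.
  have hyζ : ∀ᵐ y ∂paramMeasure, ∀ j, ξ (y j) = ζ (y j) := ae_all_iff.2 fun j =>
    (measurePreserving_eval_infinitePi (fun _ : ℕ => (volume : Measure unitInterval))
      j).quasiMeasurePreserving.ae hξζ
  let M := mulLp (domainMeasure D) (Space d)
  let A₀ := M ha₀.toLp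
  let A := fun j => M (hψ j).toLp
  let b := fun j => LinftyNorm D (ψ j)
  have hb0 : ∀ j, 0 ≤ b j := fun j => ENNReal.toReal_nonneg
  have hAb : ∀ j, ‖A j‖ ≤ b j := fun j => (norm_mulLp_le _ _).trans_eq (Lp.norm_toLp _ _)
  have hA : Summable fun j => ‖A j‖ :=
    Summable.of_nonneg_of_le (fun j => norm_nonneg _) hAb hψ_sum
  have hs : Summable fun j => ‖(hψ j).toLp‖ := by
    simp only [Lp.norm_toLp]
    exact hψ_sum
  have hweak : ∀ y : ParamSpace, (∀ j, ξ (y j) = ζ (y j)) → ∀ (q : Hminus1 D) (v : H01 D),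
      IsWeakSolution D (coeff a₀ ψ ξ y) q v ↔
        IsVariationalSolution (H01.gradL D) q (affineOperator A₀ A ζ y) v := fun y hy q v => by
    rw [isWeakSolution_iff (coeff_ae_eq ha₀ hψ hψ_sum hK hy) q v,
      ContinuousLinearMap.map_affineOperator _ _ hs hK]
  have hweaks : ∀ y : ParamSpace, (∀ j, ξ (y j) = ζ (y j)) → ∀ (s : ℕ) (q : Hminus1 D)
      (v : H01 D), IsWeakSolution D (truncCoeff a₀ ψ ξ s y) q v ↔
        IsVariationalSolution (H01.gradL D) q (truncAffineOperator A₀ A ζ s y) v :=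
    fun y hy s q v => by
      rw [isWeakSolution_iff (truncCoeff_ae_eq ha₀ hψ hy s) q v,
        ContinuousLinearMap.map_truncAffineOperator]
  have hco : ∀ᵐ y ∂paramMeasure, ∀ g, amin * ‖g‖ ^ 2 ≤ inner ℝ (affineOperator A₀ A ζ y g) g := by
    filter_upwards [hA2, hyζ] with y h1 h2 g
    rw [← ContinuousLinearMap.map_affineOperator M _ hs hK]
    refine mul_norm_sq_le_inner_mulLp _ ?_ g
    filter_upwards [h1, coeff_ae_eq ha₀ hψ hψ_sum hK h2] with x hx1 hx2
    rw [← hx2]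
    exact hx1.1
  have hcos := fun s => ae_coercive_truncAffineOperator hA hζ hK hζ_mean hco s
  have hc0 : 0 < √(poincareConst D ^ 2 + 1) := by positivity
  have hG : ∀ v, ‖v‖ ≤ √(poincareConst D ^ 2 + 1) * ‖H01.gradL D v‖ :=
    norm_le_mul_norm_grad hd D hDb
  refine ⟨⟨hcD, hpoinc⟩, ?_, ?_⟩
  · filter_upwards [hyζ, hco, ae_all_iff.2 hcos] with y hy hcy hcys q
    simp only [hweak y hy, hweaks y hy]
    exact ⟨existsUnique_isVariationalSolution (isUnit_formOperator hc0 hG hamin hcy) q,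
      fun s => existsUnique_isVariationalSolution (isUnit_formOperator hc0 hG hamin (hcys s)) q⟩
  set S := ∑' j, b j ^ p with hS
  have hS0 : 0 ≤ S := tsum_nonneg fun j => Real.rpow_nonneg (hb0 j) _
  -- One factor `1 / amin` comes from the perturbation estimate, the other from the a priori bound
  -- for `us`. The `+ 1` only ensures positivity, as `K` or `S` may vanish.
  refine ⟨poincareConst D * (K / amin ^ 2 * S ^ (1 / p)) + 1, by positivity, ?_⟩
  intro s hs1 q u us hu hus
  have hN0 := Hminus1Norm_nonneg q
  have hN : ∀ v, |q v| ≤ Hminus1Norm q * ‖H01.gradL D v‖ :=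
    abs_apply_le_Hminus1Norm (norm_le_mul_norm_grad hd D hDb) hc0.le q
  have hu' : ∀ᵐ y ∂paramMeasure,
      IsVariationalSolution (H01.gradL D) q (affineOperator A₀ A ζ y) (u y) := by
    filter_upwards [hu, hyζ] with y h1 h2 using (hweak y h2 q _).1 h1
  have hus' : ∀ᵐ y ∂paramMeasure,
      IsVariationalSolution (H01.gradL D) q (truncAffineOperator A₀ A ζ s y) (us y) := by
    filter_upwards [hus, hyζ] with y h1 h2 using (hweaks y h2 s q _).1 h1
  have : IsProbabilityMeasure paramMeasure := by unfold paramMeasure; infer_instance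
  have hmu := memLp_variationalSolution hc0 hG hamin
    (stronglyMeasurable_affineOperator A₀ hA hζ hK) hco hN0 hN hu' 2
  have hmus := memLp_variationalSolution hc0 hG hamin
    (stronglyMeasurable_truncAffineOperator A₀ A hζ s) (hcos s) hN0 hN hus' 2
  obtain ⟨hb2, hb2le⟩ := tsum_tail_sq_le hb0 hψ_anti hp0 hp1 hψ_p hs1
  have herr := integral_norm_sq_sub_le hc0 hG hamin hA hζ hK hK0 hζ_mean hco s hAb hb2 hN0 hN
    hu' hus'
  have hval : ∀ v : H01 D, ∫ x in (D : Set (Space d)), (H01.val v x) ^ 2 = ‖H01.val v‖ ^ 2 :=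
    fun v => by
      rw [norm_sq_Lp_two_eq_integral]
      simp only [Real.norm_eq_abs, sq_abs]
  have hgrad : ∀ v : H01 D,
      ∫ x in (D : Set (Space d)), ‖H01.grad v x‖ ^ 2 = ‖H01.grad v‖ ^ 2 :=
    fun v => (norm_sq_Lp_two_eq_integral _).symm
  simp only [hval, hgrad]
  have hsub := hmu.sub hmus
  have hintg : Integrable (fun y => ‖H01.grad (u y - us y)‖ ^ 2) paramMeasure :=
    ((H01.gradL D).comp_memLp' hsub).integrable_norm_pow (by simp)
  refine ⟨hmu, hmus, ?_, ?_⟩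
  · rw [Real.sqrt_le_left (by positivity), mul_pow,
      Real.sq_sqrt (integral_nonneg fun y => by positivity), ← integral_const_mul]
    refine integral_mono_of_nonneg (Filter.Eventually.of_forall fun y => by positivity)
      (hintg.const_mul _) (Filter.Eventually.of_forall fun y => ?_)
    change ‖H01.val (u y - us y)‖ ^ 2 ≤ poincareConst D ^ 2 * ‖H01.grad (u y - us y)‖ ^ 2
    rw [← mul_pow]
    gcongr
    exact hpoinc _
  · have hs0 : (0 : ℝ) ≤ s := s.cast_nonneg
    have e1 : S ^ (2 / p) = (S ^ (1 / p)) ^ 2 := by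
      rw [← Real.rpow_mul_natCast hS0]; congr 1; push_cast; ring
    have e2 : (s : ℝ) ^ (-(2 / p - 1)) = ((s : ℝ) ^ (-(1 / p - 1 / 2))) ^ 2 := by
      rw [← Real.rpow_mul_natCast hs0]; congr 1; push_cast; ring
    -- Square root of the mean square bound: the exponents `2 / p` and `-(2 / p - 1)` are halved.
    have e3 : √(∫ y, ‖H01.grad (u y - us y)‖ ^ 2 ∂paramMeasure) ≤
        K * Hminus1Norm q / amin ^ 2 * (S ^ (1 / p) * (s : ℝ) ^ (-(1 / p - 1 / 2))) := by
      rw [Real.sqrt_le_left (by positivity), mul_pow, mul_pow, ← e1, ← e2]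
      refine herr.trans ?_
      gcongr
    calc _ ≤ poincareConst D * (K * Hminus1Norm q / amin ^ 2 *
            (S ^ (1 / p) * (s : ℝ) ^ (-(1 / p - 1 / 2)))) := by gcongr
      _ = poincareConst D * (K / amin ^ 2 * S ^ (1 / p)) * Hminus1Norm q *
            (s : ℝ) ^ (-(1 / p - 1 / 2)) := by ring
      _ ≤ _ := by
        gcongr
        linarith
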